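/- Let $\mathcal A=(Q,\delta,I,Q_F\cup\delta_F)$ be a Büchi automaton over a finite alphabet $\Sigma$, with a finite set $Q$ of states, transition function $\delta\colon Q\times\Sigma\to 2^Q$, initial states $I$, accepting states $Q_F\subseteq Q$ and accepting transitions $\delta_F\subseteq\delta$; a run is accepting if some accepting state or some accepting transition occurs in it infinitely often. Put $n=|Q|$, $\delta(S,a)=\bigcup_{q\in S}\delta(q,a)$, and let $\lfloor i\rfloor_{\mathrm{ev}}$ be the largest even number $\le i$. **Ranks.** Let $\alpha\in\Sigma^\omega$. The levels of the run DAG of $\alpha$ are $\mathrm{level}_\alpha(0)=I$ and $\mathrm{level}_\alpha(k+1)=\delta(\mathrm{level}_\alpha(k),\alpha_k)$; its vertices are the pairs $(q,k)$ with $q\in\mathrm{level}_\alpha(k)$, and its edges go from $(q,k)$ to $(q',k+1)$ for $q'\in\delta(q,\alpha_k)$. Starting with $G^0$, the whole DAG, $G^{j+1}$ is obtained from $G^j$ for even $j$ by removing the vertices from which only finitely many vertices are reachable in $G^j$, and for odd $j$ by removing those from which no accepting vertex and no accepting edge is reachable in $G^j$. The rank of a vertex is the $j$ for which it is in $G^j$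 but not in $G^{j+1}$ ($\omega$ if there is none). Let $f^\alpha_k(q)$ be the rank of $(q,k)$ if $q\in\mathrm{level}_\alpha(k)$, and $0$ otherwise. **Rankings and TRUBs.** A ranking is a function $f\colon Q\to\{0,\dots,2n\}$ with even values on $Q_F$; $\mathcal R$ is the set of rankings, with the pointwise order, maximum $\sqcup$ and minimum $\sqcap$. The rank of $f$ is its largest value. A ranking is tight if its rank $r$ is odd and it takes all the values $1,3,\dots,r$. A level $\ell$ is tight for $\alpha$ if for all $k\ge\ell$ the function $f^\alpha_k$ is a tight ranking, of the same rank as $f^\alpha_\ell$. For $\alpha\notin L(\mathcal A)$, a mapping $\mu\colon 2^Q\to\mathcal R$ is a TRUB (tight rank upper bound) with respect to $\alpha$ if there is a tight level $\ell$ for $\alpha$ such that $\mu(\mathrm{level}_\alpha(k))\ge f^\alpha_k$ for all $k\ge\ell$. It is a TRUB if it is one with respect to every $\alpha\notin L(\mathcal A)$. **Update.** For $S\subseteq Q$, $a\in\Sigma$ and a ranking $f$, let $\mathrm{maxrank}^a_S(f)$ be the greatest ranking $f'$ such that for all $q\in S$: $f'(q')\le f(q)$ for all $q'\in\delta(q,a)$,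 and $f'(q')\le\lfloor f(q)\rfloor_{\mathrm{ev}}$ for all $q'\in\delta_F(q,a)$. Let $\mathrm{dec}(\theta)$ be obtained from the ranking $\theta$ by replacing each value $v=\theta(q)$ that equals the rank of $\theta$ by $\max(v-1,0)$ if $q\notin Q_F$ and by $\lfloor\max(v-1,0)\rfloor_{\mathrm{ev}}$ if $q\in Q_F$. For $\mu\colon 2^Q\to\mathcal R$ and $S\subseteq Q$ put $$\theta=\mu(S)\sqcap\bigsqcup\{\mathrm{maxrank}^a_R(\mu(R))\mid R\subseteq Q,\ a\in\Sigma,\ \delta(R,a)=S\}$$ (the empty join is the ranking that is constantly $0$), and let $\mathrm{up}_{\mathrm{in}}(\mu,S)$ be $\mathrm{dec}(\theta)$ if the rank of $\theta$ is even, and $\theta$ otherwise. Inner macrostate analysis repeats the following until $\mu(S)=\mathrm{up}_{\mathrm{in}}(\mu,S)$ for all $S\subseteq Q$: choose an $S$ for which this equation fails and change the value of $\mu$ at $S$ to $\mathrm{up}_{\mathrm{in}}(\mu,S)$. **Lemma.** If $\mu$ is a TRUB and $S\subseteq Q$, then the mapping obtained from $\mu$ by changing its value at $S$ to $\mathrm{up}_{\mathrm{in}}(\mu,S)$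 is a TRUB. The same holds for TRUBs with respect to $\alpha$, for every single $\alpha\notin L(\mathcal A)$. **Corollary.** Started with a TRUB $\mu_0$, inner macrostate analysis terminates, whatever choices of $S$ are made, and every mapping that it can return is a TRUB. Also, if the updates are made along any sequence of macrostates in which each $S\subseteq Q$ occurs infinitely often, whether or not they change $\mu$, then the mapping is constant from some point on, and this final mapping is a TRUB that satisfies $\mu(S)=\mathrm{up}_{\mathrm{in}}(\mu,S)$ for all $S$. For every single $\alpha\notin L(\mathcal A)$, if $\mu_0$ is a TRUB with respect to $\alpha$, then so is every mapping that the analysis can return. -/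

import Mathlib

open Filter

/-- A nondeterministic transition/state-based Büchi automaton with states `Q` over the alphabet
`Sym` (finiteness of `Q` and `Sym` is assumed where it is used). -/
structure BuchiAutomaton (Q Sym : Type*) where
  /-- transition function -/
  δ : Q → Sym → Set Q
  /-- initial states -/
  init : Set Q
  /-- accepting states -/
  accS : Set Q
  /-- accepting transitions -/
  accT : Q → Sym → Set Q
  accT_subset : ∀ q a, accT q a ⊆ δ q a

/-- The largest even number that is smaller than or equal to `i`. -/
def evenFloor (i : ℕ) : ℕ := i - i % 2

namespace BuchiAutomaton

variable {Q Sym : Type*}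

/-! ### Runs and the language -/

/-- The transition function on sets of states. It is also the transition function of the skeleton
automaton, whose states are the macrostates (sets of states). -/
def post (A : BuchiAutomaton Q Sym) (P : Set Q) (a : Sym) : Set Q := {q | ∃ p ∈ P, q ∈ A.δ p a}

/-- `ρ` is an (infinite) run on `α`, starting in `ρ 0`. -/
def IsRun (A : BuchiAutomaton Q Sym) (α : ℕ → Sym) (ρ : ℕ → Q) : Prop :=
  ∀ i, ρ (i + 1) ∈ A.δ (ρ i) (α i)

/-- Some accepting state or some accepting transition occurs infinitely often. -/
def IsAccepting (A : BuchiAutomaton Q Sym) (α : ℕ → Sym) (ρ : ℕ → Q) : Prop :=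
  (∃ q ∈ A.accS, ∃ᶠ i in atTop, ρ i = q) ∨
    ∃ p a q, q ∈ A.accT p a ∧ ∃ᶠ i in atTop, ρ i = p ∧ α i = a ∧ ρ (i + 1) = q

def language (A : BuchiAutomaton Q Sym) : Set (ℕ → Sym) :=
  {α | ∃ ρ : ℕ → Q, ρ 0 ∈ A.init ∧ A.IsRun α ρ ∧ A.IsAccepting α ρ}

/-! ### Run DAGs and ranks of their vertices -/

/-- The states on the `k`-th level of the run DAG over `α`: those that are reached from an initial
state by reading the first `k` symbols of `α`. -/
def level (A : BuchiAutomaton Q Sym) (α : ℕ → Sym) : ℕ → Set Q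
  | 0 => A.init
  | k + 1 => A.post (level A α k) (α k)

/-- The vertices of the run DAG over `α`. -/
def dagVertices (A : BuchiAutomaton Q Sym) (α : ℕ → Sym) : Set (Q × ℕ) :=
  {v | v.1 ∈ A.level α v.2}

/-- The edges, here between arbitrary pairs in `Q × ℕ`; they are restricted to the vertices below. -/
def DagEdge (A : BuchiAutomaton Q Sym) (α : ℕ → Sym) (u v : Q × ℕ) : Prop :=
  v.2 = u.2 + 1 ∧ v.1 ∈ A.δ u.1 (α u.2)

def DagAccEdge (A : BuchiAutomaton Q Sym) (α : ℕ → Sym) (u v : Q × ℕ) : Prop :=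
  v.2 = u.2 + 1 ∧ v.1 ∈ A.accT u.1 (α u.2)

/-- `v` is reachable from `u` in the sub-DAG induced by the set `W` of vertices. -/
def DagReach (A : BuchiAutomaton Q Sym) (α : ℕ → Sym) (W : Set (Q × ℕ)) (u v : Q × ℕ) : Prop :=
  Relation.ReflTransGen (fun x y => x ∈ W ∧ y ∈ W ∧ A.DagEdge α x y) u v

/-- The vertices of the sub-DAG `W` from which only finitely many vertices are reachable in `W`. -/
def finiteVertices (A : BuchiAutomaton Q Sym) (α : ℕ → Sym) (W : Set (Q × ℕ)) : Set (Q × ℕ) :=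
  {v | v ∈ W ∧ {u | A.DagReach α W v u}.Finite}

/-- The vertices of the sub-DAG `W` from which neither an accepting vertex nor an accepting edge
can be reached in `W`. -/
def endangeredVertices (A : BuchiAutomaton Q Sym) (α : ℕ → Sym) (W : Set (Q × ℕ)) :
    Set (Q × ℕ) :=
  {v | v ∈ W ∧ ∀ u, A.DagReach α W v u →
    u.1 ∉ A.accS ∧ ∀ u' ∈ W, ¬ A.DagAccEdge α u u'}

/-- The residual DAGs of the ranking procedure: finite vertices are removed in the steps with an
even number, endangered vertices in those with an odd number. -/
def residualDag (A : BuchiAutomaton Q Sym) (α : ℕ → Sym) : ℕ → Set (Q × ℕ)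
  | 0 => A.dagVertices α
  | j + 1 =>
    {v | v ∈ residualDag A α j ∧
      ¬ ((Even j ∧ v ∈ A.finiteVertices α (residualDag A α j)) ∨
        (Odd j ∧ v ∈ A.endangeredVertices α (residualDag A α j)))}

/-- The rank of a vertex: the number of the step that removes it; `⊤` if none does. -/
noncomputable def vertexRank (A : BuchiAutomaton Q Sym) (α : ℕ → Sym) (v : Q × ℕ) : ℕ∞ :=
  ⨅ j ∈ {j : ℕ | v ∈ A.residualDag α j ∧ v ∉ A.residualDag α (j + 1)}, (j : ℕ∞)

open Classical in
/-- The ranks of the states on level `k`; states that are not on this level get `0`. -/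
noncomputable def levelRank (A : BuchiAutomaton Q Sym) (α : ℕ → Sym) (k : ℕ) (q : Q) : ℕ∞ :=
  if q ∈ A.level α k then A.vertexRank α (q, k) else 0

/-! ### Rankings -/

/-- A (level) ranking: a function `Q → {0, …, 2 |Q|}` that is even on accepting states. -/
structure Ranking [Fintype Q] (A : BuchiAutomaton Q Sym) where
  val : Q → ℕ
  val_le : ∀ q, val q ≤ 2 * Fintype.card Q
  val_even : ∀ q ∈ A.accS, Even (val q)

namespace Ranking

variable [Fintype Q] {A : BuchiAutomaton Q Sym}

theorem val_injective : Function.Injective (Ranking.val : A.Ranking → Q → ℕ) := by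
  rintro ⟨f, _, _⟩ ⟨g, _, _⟩ h
  cases h
  rfl

/-- The pointwise order. -/
instance : PartialOrder A.Ranking := PartialOrder.lift Ranking.val val_injective

/-- The operations `⊔` and `⊓` are the pointwise maximum and minimum. -/
instance : Lattice A.Ranking where
  sup f g := ⟨fun q => max (f.val q) (g.val q), fun q => max_le (f.val_le q) (g.val_le q),
    fun q hq => by
      rcases max_choice (f.val q) (g.val q) with h | h <;> rw [h]
      exacts [f.val_even q hq, g.val_even q hq]⟩
  inf f g := ⟨fun q => min (f.val q) (g.val q), fun q => (min_le_left _ _).trans (f.val_le q),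
    fun q hq => by
      rcases min_choice (f.val q) (g.val q) with h | h <;> rw [h]
      exacts [f.val_even q hq, g.val_even q hq]⟩
  le_sup_left f g q := le_max_left (f.val q) (g.val q)
  le_sup_right f g q := le_max_right (f.val q) (g.val q)
  sup_le _ _ _ h₁ h₂ q := max_le (h₁ q) (h₂ q)
  inf_le_left f g q := min_le_left (f.val q) (g.val q)
  inf_le_right f g q := min_le_right (f.val q) (g.val q)
  le_inf _ _ _ h₁ h₂ q := le_min (h₁ q) (h₂ q)

instance : OrderBot A.Ranking where
  bot := ⟨fun _ => 0, fun _ => Nat.zero_le _, fun _ _ => Even.zero⟩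
  bot_le f q := Nat.zero_le (f.val q)

instance : Finite A.Ranking :=
  Finite.of_injective
    (fun f : A.Ranking => fun q => (⟨f.val q, Nat.lt_succ_of_le (f.val_le q)⟩ :
      Fin (2 * Fintype.card Q + 1)))
    (fun _ _ h => val_injective (funext fun q => congrArg Fin.val (congrFun h q)))

/-- The join of a set of rankings (all sets of rankings are finite); the join of the empty set is
the least ranking, which is constantly `0`. -/
noncomputable def join (M : Set A.Ranking) : A.Ranking := (Set.toFinite M).toFinset.sup id

theorem isLUB_join (M : Set A.Ranking) : IsLUB M (join M) := by
  constructor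
  · intro f hf
    exact Finset.le_sup (f := id) ((Set.Finite.mem_toFinset _).2 hf)
  · intro g hg
    exact Finset.sup_le fun f hf => hg ((Set.Finite.mem_toFinset _).1 hf)

/-- The rank of a ranking: its largest value. -/
def rank (f : A.Ranking) : ℕ := Finset.univ.sup f.val

/-- `f` is `S`-tight. -/
def TightOn (f : A.Ranking) (S : Set Q) : Prop :=
  Odd f.rank ∧ (∀ i, Odd i → i ≤ f.rank → ∃ q ∈ S, f.val q = i) ∧ ∀ q ∉ S, f.val q = 0

def Tight (f : A.Ranking) : Prop := f.TightOn Set.univ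

/-- The relation between a ranking `f` and a ranking `f'` of the successors over `a` of the states
in `S`: ranks do not grow along transitions, nor, rounded down to even numbers, along accepting
transitions. -/
def Consist (S : Set Q) (a : Sym) (f f' : A.Ranking) : Prop :=
  ∀ q ∈ S, (∀ q' ∈ A.δ q a, f'.val q' ≤ f.val q) ∧
    ∀ q' ∈ A.accT q a, f'.val q' ≤ evenFloor (f.val q)

theorem exists_isGreatest_consist (S : Set Q) (a : Sym) (f : A.Ranking) :
    ∃ g, IsGreatest {f' : A.Ranking | Consist S a f f'} g := by
  refine ⟨join {f' | Consist S a f f'}, ?_, (isLUB_join _).1⟩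
  refine Finset.sup_induction (p := fun g => Consist S a f g) ?_ ?_ ?_
  · exact fun q _ => ⟨fun _ _ => Nat.zero_le _, fun _ _ => Nat.zero_le _⟩
  · intro g₁ h₁ g₂ h₂ q hq
    exact ⟨fun q' hq' => max_le ((h₁ q hq).1 q' hq') ((h₂ q hq).1 q' hq'),
      fun q' hq' => max_le ((h₁ q hq).2 q' hq') ((h₂ q hq).2 q' hq')⟩
  · intro g hg
    exact (Set.Finite.mem_toFinset _).1 hg

/-- The greatest ranking `f'` with `Consist S a f f'`. -/
noncomputable def maxRank (S : Set Q) (a : Sym) (f : A.Ranking) : A.Ranking :=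
  (exists_isGreatest_consist S a f).choose

theorem isGreatest_maxRank (S : Set Q) (a : Sym) (f : A.Ranking) :
    IsGreatest {f' : A.Ranking | Consist S a f f'} (maxRank S a f) :=
  (exists_isGreatest_consist S a f).choose_spec

theorem val_le_rank (f : A.Ranking) (q : Q) : f.val q ≤ f.rank :=
  Finset.le_sup (Finset.mem_univ q)

open Classical in
/-- The states of maximal rank get the next smaller rank if they are not accepting, and the next
smaller even rank if they are accepting; rank `0` is not decreased. -/
noncomputable def dec (f : A.Ranking) : A.Ranking where
  val q := if f.val q = f.rank then
      (if q ∈ A.accS then evenFloor (f.val q - 1) else f.val q - 1)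
    else f.val q
  val_le q := by
    have := f.val_le q
    unfold evenFloor
    split_ifs <;> omega
  val_even q hq := by
    have := f.val_even q hq
    unfold evenFloor
    rw [if_pos hq]
    split_ifs
    · rw [Nat.even_iff]; omega
    · exact this

end Ranking

/-! ### Tight rank upper bounds -/

variable [Fintype Q]

/-- Level `ℓ` is tight in the run DAG over `α`: the ranks on each level `k ≥ ℓ` form a tight
ranking, and the rank of this ranking is the same for all these levels. -/
def TightLevel (A : BuchiAutomaton Q Sym) (α : ℕ → Sym) (ℓ : ℕ) : Prop :=
  ∃ r : ℕ, ∀ k ≥ ℓ, ∃ f : A.Ranking,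
    (∀ q, (f.val q : ℕ∞) = A.levelRank α k q) ∧ f.Tight ∧ f.rank = r

/-- `μ` is a tight rank upper bound with respect to the word `α` (used for `α` not accepted). -/
def IsTrubWrt (A : BuchiAutomaton Q Sym) (α : ℕ → Sym) (μ : Set Q → A.Ranking) : Prop :=
  ∃ ℓ, A.TightLevel α ℓ ∧ ∀ k ≥ ℓ, ∀ q, A.levelRank α k q ≤ ((μ (A.level α k)).val q : ℕ∞)

/-- `μ` is a tight rank upper bound (TRUB). -/
def IsTrub (A : BuchiAutomaton Q Sym) (μ : Set Q → A.Ranking) : Prop :=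
  ∀ α, α ∉ A.language → A.IsTrubWrt α μ

/-! ### Inner macrostate analysis -/

/-- The meet of `μ S` and the join of the greatest rankings that can be reached over `a` from the
ranking `μ R`, for all `R` and `a` with a transition from `R` to `S` over `a` in the skeleton. -/
noncomputable def innerMeet (A : BuchiAutomaton Q Sym) (μ : Set Q → A.Ranking) (S : Set Q) :
    A.Ranking :=
  μ S ⊓ Ranking.join {g | ∃ R a, A.post R a = S ∧ g = Ranking.maxRank R a (μ R)}

open Classical in
/-- The update function of the inner macrostate analysis. -/
noncomputable def updIn (A : BuchiAutomaton Q Sym) (μ : Set Q → A.Ranking) (S : Set Q) :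
    A.Ranking :=
  if Even (A.innerMeet μ S).rank then (A.innerMeet μ S).dec else A.innerMeet μ S

open Classical in
/-- The mapping `μ` with its value at `S` replaced by `A.updIn μ S`. -/
noncomputable def innerUpdate (A : BuchiAutomaton Q Sym) (μ : Set Q → A.Ranking) (S : Set Q) :
    Set Q → A.Ranking :=
  Function.update μ S (A.updIn μ S)

/-- `μ` solves the system of equations of the analysis. -/
def IsInnerFixpoint (A : BuchiAutomaton Q Sym) (μ : Set Q → A.Ranking) : Prop :=
  ∀ S, μ S = A.updIn μ S

/-- One step of the analysis: a macrostate whose equation is violated is chosen and updated. -/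
def InnerStep (A : BuchiAutomaton Q Sym) (μ μ' : Set Q → A.Ranking) : Prop :=
  ∃ S, μ S ≠ A.updIn μ S ∧ μ' = A.innerUpdate μ S

/-- The analysis, started with `μ₀`, can return `μ`: it reaches `μ`, and no equation is violated
any more. -/
def InnerReturns (A : BuchiAutomaton Q Sym) (μ₀ μ : Set Q → A.Ranking) : Prop :=
  Relation.ReflTransGen A.InnerStep μ₀ μ ∧ A.IsInnerFixpoint μ

/-- The iteration that updates the macrostates `σ 0`, `σ 1`, … one after the other. -/
noncomputable def innerIterate (A : BuchiAutomaton Q Sym) (μ₀ : Set Q → A.Ranking)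
    (σ : ℕ → Set Q) : ℕ → Set Q → A.Ranking
  | 0 => μ₀
  | i + 1 => A.innerUpdate (innerIterate A μ₀ σ i) (σ i)

end BuchiAutomaton

namespace BuchiAutomaton

variable {Q Sym : Type*}

/-! ### Ranks do not grow along the edges of the run DAG -/

/-! Vertex ranks do not grow along edges of the run DAG and drop to an even bound along accepting
edges. So if `μ` bounds the ranks on level `k`, the true ranking of level `k + 1` is consistent with
that bound (`consist_of_levelRank`) and lies below the corresponding `maxRank`, hence below the
join. Beyond a tight level the true ranking has odd rank, so below a bound of even rank it misses
the top value and survives `dec` (`le_updIn`). Hence an update preserves TRUBs, at the cost of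
moving the tight level up by one. Termination is order-theoretic: updates never increase `μ`, and
there are only finitely many mappings. -/

theorem residualDag_antitone (A : BuchiAutomaton Q Sym) (α : ℕ → Sym) :
    Antitone (A.residualDag α) :=
  antitone_nat_of_succ_le fun _ _ hv => hv.1

/-- The residual DAGs decrease, so a vertex is removed at most once. This turns bounds on ranks into
membership statements. -/
theorem vertexRank_le_iff (A : BuchiAutomaton Q Sym) (α : ℕ → Sym) {v : Q × ℕ}
    (hv : v ∈ A.dagVertices α) (i : ℕ) :
    A.vertexRank α v ≤ i ↔ v ∉ A.residualDag α (i + 1) := by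
  constructor
  · intro h hmem
    have hlt : ((i + 1 : ℕ) : ℕ∞) ≤ A.vertexRank α v := by
      refine le_iInf₂ fun j hj => ?_
      rw [Nat.cast_le]
      by_contra! hlt
      exact hj.2 (A.residualDag_antitone α hlt hmem)
    have := Nat.cast_le.1 (hlt.trans h)
    omega
  · intro h
    classical
    have hex : ∃ j, v ∉ A.residualDag α (j + 1) := ⟨i, h⟩
    -- By minimality of the index; for index `0` this is where `hv` enters.
    have hin : v ∈ A.residualDag α (Nat.find hex) := by
      rcases hfind : Nat.find hex with _ | j
      · exact hv
      · by_contra hn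
        have := Nat.find_min' hex hn
        omega
    exact (iInf₂_le (Nat.find hex) ⟨hin, Nat.find_spec hex⟩).trans
      (Nat.cast_le.2 (Nat.find_min' hex h))

/-- Whatever `v` reaches, `u` reaches too, so a reason to remove `u` in some step is also a reason
to remove `v`. -/
theorem mem_residualDag_of_dagEdge (A : BuchiAutomaton Q Sym) (α : ℕ → Sym) {u v : Q × ℕ}
    (hu : u ∈ A.dagVertices α) (huv : A.DagEdge α u v) :
    ∀ j, v ∈ A.residualDag α j → u ∈ A.residualDag α j
  | 0, _ => hu
  | j + 1, hv => by
    have huj := mem_residualDag_of_dagEdge A α hu huv j hv.1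
    have hreach : ∀ w, A.DagReach α (A.residualDag α j) v w →
        A.DagReach α (A.residualDag α j) u w :=
      fun w hw => Relation.ReflTransGen.head ⟨huj, hv.1, huv⟩ hw
    refine ⟨huj, ?_⟩
    rintro (⟨hj, -, hfin⟩ | ⟨hj, -, hend⟩)
    · exact hv.2 (Or.inl ⟨hj, hv.1, hfin.subset hreach⟩)
    · exact hv.2 (Or.inr ⟨hj, hv.1, fun w hw => hend w (hreach w hw)⟩)

theorem dagEdge_of_dagAccEdge (A : BuchiAutomaton Q Sym) {α : ℕ → Sym} {u v : Q × ℕ}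
    (huv : A.DagAccEdge α u v) : A.DagEdge α u v :=
  ⟨huv.1, A.accT_subset _ _ huv.2⟩

theorem mem_dagVertices_of_dagEdge (A : BuchiAutomaton Q Sym) {α : ℕ → Sym} {u v : Q × ℕ}
    (hu : u ∈ A.dagVertices α) (huv : A.DagEdge α u v) : v ∈ A.dagVertices α := by
  obtain ⟨q, k⟩ := u
  obtain ⟨q', k'⟩ := v
  obtain ⟨rfl, hq'⟩ := huv
  exact ⟨q, hu, hq'⟩

theorem vertexRank_le_of_dagEdge (A : BuchiAutomaton Q Sym) (α : ℕ → Sym) {u v : Q × ℕ}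
    (hu : u ∈ A.dagVertices α) (huv : A.DagEdge α u v) {i : ℕ} (hi : A.vertexRank α u ≤ i) :
    A.vertexRank α v ≤ i := by
  rw [vertexRank_le_iff A α (A.mem_dagVertices_of_dagEdge hu huv)]
  rw [vertexRank_le_iff A α hu] at hi
  exact fun hv => hi (A.mem_residualDag_of_dagEdge α hu huv _ hv)

theorem vertexRank_le_of_dagAccEdge (A : BuchiAutomaton Q Sym) (α : ℕ → Sym) {u v : Q × ℕ}
    (hu : u ∈ A.dagVertices α) (huv : A.DagAccEdge α u v) {i : ℕ} (hi : A.vertexRank α u ≤ i) :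
    A.vertexRank α v ≤ evenFloor i := by
  have he := A.dagEdge_of_dagAccEdge huv
  rcases Nat.even_or_odd' i with ⟨m, rfl | rfl⟩
  · have : evenFloor (2 * m) = 2 * m := by unfold evenFloor; omega
    rw [this]
    exact A.vertexRank_le_of_dagEdge α hu he hi
  · have : evenFloor (2 * m + 1) = 2 * m := by unfold evenFloor; omega
    rw [this, vertexRank_le_iff A α (A.mem_dagVertices_of_dagEdge hu he)]
    rw [vertexRank_le_iff A α hu] at hi
    intro hv
    -- If `v` were still present before the odd step `2 * m + 1`, the accepting edge to `v` would
    -- keep `u` from being endangered, and `u` would survive that step.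
    refine hi ⟨A.mem_residualDag_of_dagEdge α hu he _ hv, ?_⟩
    rintro (⟨hev, -⟩ | ⟨-, -, hend⟩)
    · exact (Nat.not_even_iff_odd.2 ⟨m, rfl⟩) hev
    · exact (hend u Relation.ReflTransGen.refl).2 v hv huv

variable [Fintype Q]

/-- The ranks on a level are consistent with every upper bound of the ranks on the level before. -/
theorem consist_of_levelRank (A : BuchiAutomaton Q Sym) (α : ℕ → Sym) (k : ℕ)
    {f f' : A.Ranking} (hf : ∀ q, A.levelRank α k q ≤ f.val q)
    (hf' : ∀ q, (f'.val q : ℕ∞) = A.levelRank α (k + 1) q) :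
    Ranking.Consist (A.level α k) (α k) f f' := by
  intro q hq
  have hrank : A.vertexRank α (q, k) ≤ f.val q := by
    simpa only [levelRank, if_pos hq] using hf q
  have hsucc : ∀ q' ∈ A.δ q (α k), (f'.val q' : ℕ∞) = A.vertexRank α (q', k + 1) := by
    intro q' hq'
    have hmem : q' ∈ A.level α (k + 1) := ⟨q, hq, hq'⟩
    rw [hf', levelRank, if_pos hmem]
  have hu : (q, k) ∈ A.dagVertices α := hq
  constructor
  · intro q' hq'
    have h := A.vertexRank_le_of_dagEdge α (v := (q', k + 1)) hu ⟨rfl, hq'⟩ hrank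
    rw [← hsucc q' hq'] at h
    exact Nat.cast_le.1 h
  · intro q' hq'
    have h := A.vertexRank_le_of_dagAccEdge α (v := (q', k + 1)) hu ⟨rfl, hq'⟩ hrank
    rw [← hsucc q' (A.accT_subset _ _ hq')] at h
    exact Nat.cast_le.1 h

/-! ### The update function -/

namespace Ranking

variable {A : BuchiAutomaton Q Sym}

theorem rank_mono {f g : A.Ranking} (h : f ≤ g) : f.rank ≤ g.rank :=
  Finset.sup_mono_fun fun q _ => h q

theorem dec_le (f : A.Ranking) : f.dec ≤ f := by
  intro q
  change (dec f).val q ≤ f.val q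
  simp only [dec, evenFloor]
  split_ifs <;> omega

/-- Only the top values of `g` are lowered, and `f` lies strictly below these. On accepting states
`f` is even, so rounding down to an even value does no harm. -/
theorem le_dec {f g : A.Ranking} (h : f ≤ g) (hlt : f.rank < g.rank) : f ≤ g.dec := by
  intro q
  change f.val q ≤ (dec g).val q
  have hq : f.val q ≤ g.val q := h q
  have hr := f.val_le_rank q
  simp only [dec, evenFloor]
  split_ifs with h₁ h₂
  · have := Nat.even_iff.1 (f.val_even q h₂)
    omega
  · omega
  · exact hq

end Ranking

theorem updIn_le (A : BuchiAutomaton Q Sym) (μ : Set Q → A.Ranking) (S : Set Q) :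
    A.updIn μ S ≤ μ S := by
  have h : A.innerMeet μ S ≤ μ S := inf_le_left
  unfold updIn
  split_ifs
  exacts [(Ranking.dec_le _).trans h, h]

theorem le_updIn (A : BuchiAutomaton Q Sym) {μ : Set Q → A.Ranking} {S : Set Q} {f : A.Ranking}
    (hf : f ≤ A.innerMeet μ S) (hodd : Odd f.rank) : f ≤ A.updIn μ S := by
  unfold updIn
  split_ifs with hev
  · refine Ranking.le_dec hf ((Ranking.rank_mono hf).lt_of_ne fun h => ?_)
    rw [← h] at hev
    exact Nat.not_even_iff_odd.2 hodd hev
  · exact hf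

/-! ### Updates preserve TRUBs -/

theorem TightLevel.mono {A : BuchiAutomaton Q Sym} {α : ℕ → Sym} {ℓ ℓ' : ℕ}
    (h : A.TightLevel α ℓ) (hle : ℓ ≤ ℓ') : A.TightLevel α ℓ' :=
  h.imp fun _ hr k hk => hr k (hle.trans hk)

theorem IsTrubWrt.innerUpdate {A : BuchiAutomaton Q Sym} {α : ℕ → Sym} {μ : Set Q → A.Ranking}
    (h : A.IsTrubWrt α μ) (S : Set Q) : A.IsTrubWrt α (A.innerUpdate μ S) := by
  obtain ⟨ℓ, htight, hbound⟩ := h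
  -- The bound must already hold on the preceding level, hence `ℓ + 1`.
  refine ⟨ℓ + 1, htight.mono ℓ.le_succ, fun k hk q => ?_⟩
  by_cases hS : A.level α k = S
  · obtain ⟨k, rfl⟩ : ∃ j, k = j + 1 := ⟨k - 1, by omega⟩
    obtain ⟨r, hr⟩ := htight
    obtain ⟨f, hf, hft, -⟩ := hr (k + 1) (by omega)
    have hle : f ≤ A.innerMeet μ S := by
      refine le_inf (fun p => ?_) ?_
      · have := hbound (k + 1) (by omega) p
        rw [← hf, hS] at this
        exact Nat.cast_le.1 this
      -- The preceding level is one of the skeleton predecessors of `S`, so its `maxRank` occurs in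
      -- the join.
      · exact ((Ranking.isGreatest_maxRank _ _ _).2
          (A.consist_of_levelRank α k (hbound k (by omega)) hf)).trans
          ((Ranking.isLUB_join _).1 ⟨A.level α k, α k, hS, rfl⟩)
    rw [BuchiAutomaton.innerUpdate, hS, Function.update_self, ← hf, Nat.cast_le]
    exact A.le_updIn hle hft.1 q
  · rw [BuchiAutomaton.innerUpdate, Function.update_of_ne hS]
    exact hbound k (by omega) q

theorem IsTrub.innerUpdate {A : BuchiAutomaton Q Sym} {μ : Set Q → A.Ranking}
    (h : A.IsTrub μ) (S : Set Q) : A.IsTrub (A.innerUpdate μ S) :=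
  fun α hα => (h α hα).innerUpdate S

/-! ### Termination -/

theorem innerUpdate_le (A : BuchiAutomaton Q Sym) (μ : Set Q → A.Ranking) (S : Set Q) :
    A.innerUpdate μ S ≤ μ := by
  classical
  intro R
  by_cases h : R = S
  · subst h
    rw [innerUpdate, Function.update_self]
    exact A.updIn_le μ R
  · rw [innerUpdate, Function.update_of_ne h]

theorem innerUpdate_eq_self_iff (A : BuchiAutomaton Q Sym) (μ : Set Q → A.Ranking) (S : Set Q) :
    A.innerUpdate μ S = μ ↔ μ S = A.updIn μ S := by
  rw [innerUpdate, Function.update_eq_self_iff, eq_comm]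

theorem InnerStep.lt {A : BuchiAutomaton Q Sym} {μ μ' : Set Q → A.Ranking}
    (h : A.InnerStep μ μ') : μ' < μ := by
  obtain ⟨S, hS, rfl⟩ := h
  exact (A.innerUpdate_le μ S).lt_of_ne fun he => hS ((A.innerUpdate_eq_self_iff μ S).1 he)

theorem exists_innerReturns (A : BuchiAutomaton Q Sym) (μ₀ : Set Q → A.Ranking) :
    ∃ μ, A.InnerReturns μ₀ μ := by
  induction μ₀ using WellFoundedLT.induction with
  | ind μ₀ ih =>
    by_cases h : A.IsInnerFixpoint μ₀
    · exact ⟨μ₀, Relation.ReflTransGen.refl, h⟩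
    · obtain ⟨S, hS⟩ := not_forall.1 h
      have hstep : A.InnerStep μ₀ (A.innerUpdate μ₀ S) := ⟨S, hS, rfl⟩
      obtain ⟨μ, hμ, hfix⟩ := ih _ hstep.lt
      exact ⟨μ, Relation.ReflTransGen.head hstep hμ, hfix⟩

theorem IsTrubWrt.of_innerReturns {A : BuchiAutomaton Q Sym} {α : ℕ → Sym}
    {μ₀ μ : Set Q → A.Ranking} (h₀ : A.IsTrubWrt α μ₀) (h : A.InnerReturns μ₀ μ) :
    A.IsTrubWrt α μ := by
  obtain ⟨hreach, -⟩ := h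
  induction hreach with
  | refl => exact h₀
  | tail _ hstep ih =>
    obtain ⟨S, -, rfl⟩ := hstep
    exact ih.innerUpdate S

theorem IsTrub.innerIterate {A : BuchiAutomaton Q Sym} {μ₀ : Set Q → A.Ranking}
    (h : A.IsTrub μ₀) (σ : ℕ → Set Q) : ∀ i, A.IsTrub (A.innerIterate μ₀ σ i)
  | 0 => h
  | i + 1 => (IsTrub.innerIterate h σ i).innerUpdate (σ i)

theorem innerIterate_antitone (A : BuchiAutomaton Q Sym) (μ₀ : Set Q → A.Ranking)
    (σ : ℕ → Set Q) : Antitone (A.innerIterate μ₀ σ) :=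
  antitone_nat_of_succ_le fun i => A.innerUpdate_le (A.innerIterate μ₀ σ i) (σ i)

theorem innerIterate_eventually_const (A : BuchiAutomaton Q Sym) (μ₀ : Set Q → A.Ranking)
    (σ : ℕ → Set Q) : ∃ N, ∀ i ≥ N, A.innerIterate μ₀ σ i = A.innerIterate μ₀ σ N := by
  obtain ⟨N, hN⟩ := WellFoundedGT.monotone_chain_condition
    (α := (Set Q → A.Ranking)ᵒᵈ) ⟨A.innerIterate μ₀ σ, A.innerIterate_antitone μ₀ σ⟩
  exact ⟨N, fun i hi => (hN i hi).symm⟩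

/-- Each macrostate is updated again after stabilization, and that update changes nothing, so its
equation holds. -/
theorem isInnerFixpoint_innerIterate {A : BuchiAutomaton Q Sym} {μ₀ : Set Q → A.Ranking}
    {σ : ℕ → Set Q} (hσ : ∀ S, ∃ᶠ i in atTop, σ i = S) {N : ℕ}
    (hN : ∀ i ≥ N, A.innerIterate μ₀ σ i = A.innerIterate μ₀ σ N) :
    A.IsInnerFixpoint (A.innerIterate μ₀ σ N) := by
  intro S
  obtain ⟨i, hi, rfl⟩ := frequently_atTop.1 (hσ S) N
  rw [← A.innerUpdate_eq_self_iff, ← hN i hi]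
  exact (hN (i + 1) (by omega)).trans (hN i hi).symm

end BuchiAutomaton

theorem mainTheorem6 {Q Sym : Type*} [Fintype Q] [Finite Sym] (A : BuchiAutomaton Q Sym) :
    -- the update of a TRUB is a TRUB, also for each single word outside the language
    (∀ (μ : Set Q → A.Ranking) (S : Set Q), A.IsTrub μ → A.IsTrub (A.innerUpdate μ S)) ∧
    (∀ α, α ∉ A.language → ∀ (μ : Set Q → A.Ranking) (S : Set Q),
      A.IsTrubWrt α μ → A.IsTrubWrt α (A.innerUpdate μ S)) ∧
    -- started with a TRUB, the analysis terminates and whatever it returns is a TRUB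
    (∀ μ₀ : Set Q → A.Ranking, A.IsTrub μ₀ →
      (¬ ∃ m : ℕ → Set Q → A.Ranking, m 0 = μ₀ ∧ ∀ i, A.InnerStep (m i) (m (i + 1))) ∧
      (∃ μ, A.InnerReturns μ₀ μ) ∧
      (∀ μ, A.InnerReturns μ₀ μ → A.IsTrub μ) ∧
      -- the same for each iteration that considers every macrostate again and again
      (∀ σ : ℕ → Set Q, (∀ S, ∃ᶠ i in atTop, σ i = S) →
        ∃ N, (∀ i ≥ N, A.innerIterate μ₀ σ i = A.innerIterate μ₀ σ N) ∧
          A.IsInnerFixpoint (A.innerIterate μ₀ σ N) ∧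
          A.IsTrub (A.innerIterate μ₀ σ N))) ∧
    -- also for each single word outside the language
    (∀ α, α ∉ A.language → ∀ μ₀ μ : Set Q → A.Ranking,
      A.IsTrubWrt α μ₀ → A.InnerReturns μ₀ μ → A.IsTrubWrt α μ) := by
  refine ⟨fun μ S h => h.innerUpdate S, fun α _ μ S h => h.innerUpdate S, fun μ₀ h₀ => ?_,
    fun α _ μ₀ μ h₀ h => h₀.of_innerReturns h⟩
  refine ⟨?_, A.exists_innerReturns μ₀, fun μ h α hα => (h₀ α hα).of_innerReturns h,
    fun σ hσ => ?_⟩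
  · rintro ⟨m, -, hm⟩
    exact not_strictAnti_of_wellFoundedLT m (strictAnti_nat_of_succ_lt fun i => (hm i).lt)
  · obtain ⟨N, hN⟩ := A.innerIterate_eventually_const μ₀ σ
    exact ⟨N, hN, BuchiAutomaton.isInnerFixpoint_innerIterate hσ hN, h₀.innerIterate σ N⟩
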